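/- Let $m$ and $n$ be positive integers, and let $X=\{x_1,\dots,x_n\}$ and $Y=\{y_1,\dots,y_m\}$ be two sets of variables; more generally, let $x_1,\dots,x_n,y_1,\dots,y_m$ be any elements of a field with $x_i\neq y_j$ for all $i,j$. The permanent of an $n\times m$ matrix $A=(a_{ij})$ is $\operatorname{per}(A)=\sum_f\prod_{i=1}^n a_{i,f(i)}$, where $f$ runs over all injective maps $\{1,\dots,n\}\to\{1,\dots,m\}$. Put $R(X,Y)=\prod_{i=1}^n\prod_{j=1}^m(x_i-y_j)$, $$H(X)=\bigl(h_{j-i}(X)\bigr)_{1\le i\le n,\ 1\le j\le m+n-1},$$ $$E(Y)=\bigl((j-2k+2)(-1)^{m-j+k-1}e_{m-j+k-1}(Y)\bigr)_{1\le j\le m+n-1,\ 1\le k\le n},$$ where $h_s(X)$ and $e_s(Y)$ are the complete homogeneous symmetric function of degree $s$ in the variables $X$ and the elementary symmetric function of degree $s$ in the variables $Y$, with $h_s=e_s=0$ for $s<0$. Then $$\operatorname{per}\left(\frac1{x_i-y_j}\right)_{1\le i\le n,\ 1\le j\le m}=\frac{\det\bigl(H(X)E(Y)\bigr)}{R(X,Y)}.$$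 If $m<n$, then both sides vanish. -/

import Mathlib

namespace ScottPermanent

/-- The permanent of a rectangular `n × m` matrix: the sum of all products of `n` entries, one
from each row, no two of which lie in the same column. (If `m < n` there are no such choices and
the sum is empty.) -/
noncomputable def rectPermanent {K : Type*} [Field K] {n m : ℕ} (A : Matrix (Fin n) (Fin m) K) : K :=
  ∑ f : Fin n ↪ Fin m, ∏ i, A i (f i)

/-- The matrix `(1 / (x_i - y_j))`. -/
noncomputable def cauchyMatrix {K : Type*} [Field K] {n m : ℕ} (x : Fin n → K) (y : Fin m → K) :
    Matrix (Fin n) (Fin m) K :=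
  Matrix.of fun i j => 1 / (x i - y j)

/-- `R(X, Y) = ∏ (x_i - y_j)`. -/
noncomputable def R {K : Type*} [Field K] {n m : ℕ} (x : Fin n → K) (y : Fin m → K) : K :=
  ∏ i, ∏ j, (x i - y j)

/-- The complete homogeneous symmetric function `h_s(X)` of integer degree `s`, which is `0` for
`s < 0`. -/
noncomputable def h {K : Type*} [Field K] {n : ℕ} (x : Fin n → K) (s : ℤ) : K :=
  if 0 ≤ s then MvPolynomial.eval x (MvPolynomial.hsymm (Fin n) K s.toNat) else 0

/-- The elementary symmetric function `e_s(Y)` of integer degree `s`, which is `0` for `s < 0`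
(and for `s > m`). -/
noncomputable def e {K : Type*} [Field K] {m : ℕ} (y : Fin m → K) (s : ℤ) : K :=
  if 0 ≤ s then MvPolynomial.eval y (MvPolynomial.esymm (Fin m) K s.toNat) else 0

/-- The entry of `E(Y)` in row `j` and column `k`, where rows and columns are counted from `1`:
`(j - 2k + 2) (-1)^(m-j+k-1) e_{m-j+k-1}(Y)`. -/
noncomputable def entryE {K : Type*} [Field K] {m : ℕ} (y : Fin m → K) (j k : ℤ) : K :=
  ((j - 2 * k + 2 : ℤ) : K) * (-1 : K) ^ ((m : ℤ) - j + k - 1) * e y ((m : ℤ) - j + k - 1)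

/-- The `n × (m+n-1)` matrix `H(X) = (h_{j-i}(X))`. `Fin` counts from `0`; the rows `i` and
columns `j` of the formula count from `1`. -/
noncomputable def matrixH {K : Type*} [Field K] {n : ℕ} (m : ℕ) (x : Fin n → K) :
    Matrix (Fin n) (Fin (m + n - 1)) K :=
  Matrix.of fun i j => h x (((j : ℕ) + 1 : ℤ) - ((i : ℕ) + 1 : ℤ))

/-- The `(m+n-1) × n` matrix `E(Y)`. `Fin` counts from `0`; the rows and columns of the formula
count from `1`. -/
noncomputable def matrixE {K : Type*} [Field K] {m : ℕ} (n : ℕ) (y : Fin m → K) :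
    Matrix (Fin (m + n - 1)) (Fin n) K :=
  Matrix.of fun j k => entryE y ((j : ℕ) + 1 : ℤ) ((k : ℕ) + 1 : ℤ)

end ScottPermanent

namespace ScottPermanent

open Polynomial

/-! Let P(t) = ∏ (t - y_j) and s_i = ∑_j 1/(x_i - y_j) = P'(x_i)/P(x_i). The columns of E(Y) are the
coefficients of t^k P' - k t^(k-1) P, whose value at x_i is P(x_i) (s_i x_i^k - k x_i^(k-1)).
Multiplying det(H E) by the Vandermonde determinant V turns coefficients into values at the x_i
(`vandermonde_mul_det_hsymmMatrix_mul`), so for distinct x_i the claim becomes det(s_i x_i^k - k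
x_i^(k-1)) = V · per (`shiftedDet_eq_vandermonde_mul_rectPermanent`).

This is proved by induction on m. After clearing the denominators of the added node y, both sides
are polynomials in y of degree at most the number of rows; they agree at every x_i and in the top
coefficient (`det_add_node`). Coinciding x_i are handled by perturbation, once denominators are
cleared (`detHE_eq_permNumerator`). -/

/-! ### Expansion of the rectangular permanent along a column -/

/-- An injection either avoids column 0 or hits it from exactly one row. -/
theorem rectPermanent_succ {K : Type*} [Field K] {n m : ℕ}
    (A : Matrix (Fin (n + 1)) (Fin (m + 1)) K) :
    rectPermanent A = rectPermanent (A.submatrix id Fin.succ) +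
      ∑ i, A i 0 * rectPermanent (A.submatrix i.succAbove Fin.succ) := by
  classical
  have split : rectPermanent A =
      ∑ f : Fin (n + 1) ↪ Fin (m + 1) with ∀ i, f i ≠ 0, ∏ i, A i (f i) +
      ∑ i, ∑ f : Fin (n + 1) ↪ Fin (m + 1) with f i = 0, ∏ i, A i (f i) := by
    rw [rectPermanent]
    simp_rw [Finset.sum_filter]
    rw [Finset.sum_comm, ← Finset.sum_add_distrib]
    refine Finset.sum_congr rfl fun f _ => ?_
    by_cases hf : ∀ i, f i ≠ 0
    · simp [hf]
    · rw [if_neg hf]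
      push Not at hf
      obtain ⟨i, hi⟩ := hf
      rw [Finset.sum_eq_single i]
      · simp [hi]
      · intro j _ hj
        rw [if_neg]
        intro h0
        exact hj (f.injective (h0.trans hi.symm))
      · simp
  rw [split]
  congr 1
  · symm
    rw [rectPermanent]
    refine Finset.sum_bij (fun g _ => g.trans (Fin.succEmb m)) ?_ ?_ ?_ ?_
    · intro g _
      simp
    · intro g _ g' _ h
      ext i
      have := DFunLike.congr_fun h i
      simpa using congrArg Fin.val this
    · intro f hf
      simp only [Finset.mem_filter, Finset.mem_univ, true_and] at hf
      refine ⟨⟨fun i => (f i).pred (hf i), fun i j h => f.injective (by simpa using h)⟩,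
        Finset.mem_univ _, ?_⟩
      ext i
      exact congrArg Fin.val (Fin.succ_pred (f i) (hf i))
    · intro g _
      simp
  · refine Finset.sum_congr rfl fun i _ => ?_
    symm
    rw [rectPermanent, Finset.mul_sum]
    have inj (g : Fin n ↪ Fin m) : Function.Injective
        (i.insertNth (α := fun _ => Fin (m + 1)) 0 (fun j => (g j).succ)) := by
      intro a b
      refine Fin.succAboveCases i ?_ (fun a' => ?_) a <;>
        refine Fin.succAboveCases i ?_ (fun b' => ?_) b <;> simp [eq_comm, (Fin.succ_ne_zero _).symm]
    refine Finset.sum_bij (fun g _ => ⟨_, inj g⟩) ?_ ?_ ?_ ?_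
    · intro g _
      simp
    · intro g _ g' _ h
      ext j
      have := DFunLike.congr_fun h (i.succAbove j)
      simpa using congrArg Fin.val this
    · intro f hf
      simp only [Finset.mem_filter, Finset.mem_univ, true_and] at hf
      have hne (j : Fin n) : f (i.succAbove j) ≠ 0 := fun h =>
        i.succAbove_ne j (f.injective (h.trans hf.symm))
      refine ⟨⟨fun j => (f (i.succAbove j)).pred (hne j), fun a b h => ?_⟩,
        Finset.mem_univ _, ?_⟩
      · simpa using h
      · ext a
        refine Fin.succAboveCases i ?_ (fun a' => ?_) a
        · simp [hf]
        · simp only [Function.Embedding.coeFn_mk, Fin.insertNth_apply_succAbove]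
          exact congrArg Fin.val (Fin.succ_pred (f (i.succAbove a')) (hne a'))
    · intro g _
      rw [Fin.prod_univ_succAbove _ i]
      simp

theorem rectPermanent_zero_rows {K : Type*} [Field K] {m : ℕ} (A : Matrix (Fin 0) (Fin m) K) :
    rectPermanent A = 1 := by
  simp [rectPermanent]

theorem rectPermanent_eq_zero {K : Type*} [Field K] {n m : ℕ} (hmn : m < n)
    (A : Matrix (Fin n) (Fin m) K) : rectPermanent A = 0 := by
  have : IsEmpty (Fin n ↪ Fin m) := ⟨fun f => by
    have := Fintype.card_le_of_embedding f
    simp at this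
    omega⟩
  simp [rectPermanent]

/-! ### Determinants of linear functionals on polynomials -/

/-- Replacing the monomial basis by monic polynomials of the same degrees does not change the
determinant of the values of linear functionals. -/
theorem det_functional_monic {A : Type*} [CommRing A] {n : ℕ} (l : Fin n → A[X] →ₗ[A] A)
    (p : Fin n → A[X]) (hdeg : ∀ k, (p k).natDegree = k) (hmonic : ∀ k, (p k).Monic) :
    (Matrix.of fun i k => l i (p k)).det =
      (Matrix.of fun i (k : Fin n) => l i (X ^ (k : ℕ))).det := by
  have : (Matrix.of fun i k => l i (p k)) =
      (Matrix.of fun i (k : Fin n) => l i (X ^ (k : ℕ))) *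
        (Matrix.of fun (i j : Fin n) => (p j).coeff i) := by
    ext i k
    rw [Matrix.mul_apply]
    simp only [Matrix.of_apply]
    conv_lhs => rw [(p k).as_sum_range' n (by rw [hdeg]; exact k.2), map_sum,
      Finset.sum_range]
    refine Finset.sum_congr rfl fun s _ => ?_
    rw [← mul_one ((p k).coeff s), ← smul_eq_mul, ← smul_monomial, map_smul, smul_eq_mul,
      mul_comm, ← X_pow_eq_monomial]
    simp
  rw [this, Matrix.det_mul, Matrix.det_matrixOfPolynomials p hdeg hmonic, mul_one]

/-- In the basis of powers of X - c, evaluation at c becomes the row (1, 0, …, 0), ready for Laplace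
expansion. -/
theorem det_functional_sub_pow {A : Type*} [CommRing A] [Nontrivial A] {n : ℕ}
    (l : Fin n → A[X] →ₗ[A] A) (c : A) :
    (Matrix.of fun i (k : Fin n) => l i ((X - C c) ^ (k : ℕ))).det =
      (Matrix.of fun i (k : Fin n) => l i (X ^ (k : ℕ))).det :=
  det_functional_monic l _ (fun k => by
    rw [(monic_X_sub_C c).natDegree_pow, natDegree_X_sub_C, mul_one]) fun k =>
    (monic_X_sub_C c).pow _

theorem det_of_row_eq_single {A : Type*} [CommRing A] {n : ℕ}
    (M : Matrix (Fin (n + 1)) (Fin (n + 1)) A) (i : Fin (n + 1)) (h0 : M i 0 = 1)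
    (hs : ∀ k : Fin n, M i k.succ = 0) :
    M.det = (-1) ^ (i : ℕ) * (M.submatrix i.succAbove Fin.succ).det := by
  rw [Matrix.det_succ_row M i, Fin.sum_univ_succ]
  simp only [hs, h0, mul_zero, zero_mul, Finset.sum_const_zero, add_zero, mul_one, Fin.val_zero,
    Fin.succAbove_zero]

theorem det_vandermonde_succAbove {A : Type*} [CommRing A] [Nontrivial A] {n : ℕ}
    (x : Fin (n + 1) → A) (i : Fin (n + 1)) :
    (Matrix.vandermonde x).det = (-1) ^ (i : ℕ) *
      ((∏ j, (x (i.succAbove j) - x i)) * (Matrix.vandermonde (x ∘ i.succAbove)).det) := by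
  have h1 : (Matrix.vandermonde x).det =
      (Matrix.of fun j (k : Fin (n + 1)) => leval (x j) (X ^ (k : ℕ))).det := by
    congr 1
    ext j k
    simp [Matrix.vandermonde]
  have h2 : (Matrix.vandermonde (x ∘ i.succAbove)).det =
      (Matrix.of fun j (k : Fin n) => leval (x (i.succAbove j)) (X ^ (k : ℕ))).det := by
    congr 1
    ext j k
    simp [Matrix.vandermonde]
  rw [h1, ← det_functional_sub_pow _ (x i), det_of_row_eq_single _ i (by simp) (by simp), h2,
    ← det_functional_sub_pow (fun j => leval (x (i.succAbove j))) (x i), ← Matrix.det_mul_column]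
  congr 2
  ext j k
  simp [pow_succ']

/-! ### The permanent as a quotient of determinants -/

/-- The functional `p ↦ s * p(a) - p'(a)`. -/
noncomputable def shiftedDeriv {A : Type*} [CommRing A] (s a : A) : A[X] →ₗ[A] A :=
  s • leval a - leval a ∘ₗ derivative

theorem shiftedDeriv_apply {A : Type*} [CommRing A] (s a : A) (p : A[X]) :
    shiftedDeriv s a p = s * p.eval a - (derivative p).eval a := by
  simp [shiftedDeriv]

/-- The determinant of the functionals `p ↦ s_i p(x_i) - p'(x_i)` on the monomial basis. -/
noncomputable def shiftedDet {A : Type*} [CommRing A] {n : ℕ} (s x : Fin n → A) : A :=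
  (Matrix.of fun i (k : Fin n) => shiftedDeriv (s i) (x i) (X ^ (k : ℕ))).det

/-- Row i reduces to evaluation at x_i. Recentre there: with d = x_j - x_i, the other rows satisfy d
(s d^(k+1) - (k+1) d^k) + d^(k+1) = d² (s d^k - k d^(k-1)), the same functionals with one node
fewer. -/
theorem det_shiftedDeriv_at_node {A : Type*} [CommRing A] [Nontrivial A] {n : ℕ}
    (s x : Fin (n + 1) → A) (i : Fin (n + 1)) :
    (Matrix.of fun j (k : Fin (n + 1)) =>
      (x j - x i) * shiftedDeriv (s j) (x j) (X ^ (k : ℕ)) + x j ^ (k : ℕ)).det =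
    (-1) ^ (i : ℕ) * ((∏ j, (x (i.succAbove j) - x i) ^ 2) *
      shiftedDet (s ∘ i.succAbove) (x ∘ i.succAbove)) := by
  have h1 : (Matrix.of fun j (k : Fin (n + 1)) =>
      (x j - x i) * shiftedDeriv (s j) (x j) (X ^ (k : ℕ)) + x j ^ (k : ℕ)) =
      (Matrix.of fun j (k : Fin (n + 1)) =>
        ((x j - x i) • shiftedDeriv (s j) (x j) + leval (x j)) (X ^ (k : ℕ))) := by
    ext j k
    simp
  rw [h1, ← det_functional_sub_pow _ (x i),
    det_of_row_eq_single _ i (by simp) (by simp), shiftedDet,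
    ← det_functional_sub_pow _ (x i), ← Matrix.det_mul_column]
  congr 2
  ext j k
  simp only [Matrix.submatrix_apply, Matrix.of_apply, LinearMap.add_apply, LinearMap.smul_apply,
    shiftedDeriv_apply, smul_eq_mul, leval_apply, Fin.val_succ, Function.comp_apply, pow_succ,
    derivative_mul, eval_add, eval_mul, eval_sub, eval_X, eval_C, eval_pow, derivative_sub,
    derivative_X, derivative_C, sub_zero, eval_one]
  ring

/-- Comparing two polynomials in the added node at `x_1, …, x_n` and at infinity. -/
theorem det_add_node {K : Type*} [Field K] {n : ℕ} (s x : Fin (n + 1) → K)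
    (hx : Function.Injective x) (p₀ : K) (p : Fin (n + 1) → K)
    (h0 : shiftedDet s x = (Matrix.vandermonde x).det * p₀)
    (hp : ∀ i, shiftedDet (s ∘ i.succAbove) (x ∘ i.succAbove) =
      (Matrix.vandermonde (x ∘ i.succAbove)).det * p i) (y : K) :
    (Matrix.of fun j (k : Fin (n + 1)) =>
      (x j - y) * shiftedDeriv (s j) (x j) (X ^ (k : ℕ)) + x j ^ (k : ℕ)).det =
    (Matrix.vandermonde x).det *
      (p₀ * ∏ i, (x i - y) + ∑ i, p i * ∏ j, (x (i.succAbove j) - y)) := by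
  set r : Matrix (Fin (n + 1)) (Fin (n + 1)) K :=
    Matrix.of fun j k => shiftedDeriv (s j) (x j) (X ^ (k : ℕ)) with hr
  set b : Matrix (Fin (n + 1)) (Fin (n + 1)) K :=
    Matrix.of fun j k => x j * r j k + x j ^ (k : ℕ) with hb
  -- The matrix is affine in y, with slope -r and value b at y = 0; this bounds the degree and gives
  -- det(-r) as top coefficient.
  set F : K[X] := ((X : K[X]) • (-r).map C + b.map C).det with hF
  set G : K[X] := C (Matrix.vandermonde x).det *
    (C p₀ * ∏ i, (C (x i) - X) + ∑ i, C (p i) * ∏ j, (C (x (i.succAbove j)) - X)) with hG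
  have evalF (z : K) : F.eval z = (Matrix.of fun j (k : Fin (n + 1)) =>
      (x j - z) * shiftedDeriv (s j) (x j) (X ^ (k : ℕ)) + x j ^ (k : ℕ)).det := by
    rw [hF, ← coe_evalRingHom, RingHom.map_det]
    congr 1
    ext j k
    simp [hb, hr]
    ring
  have evalG (z : K) : G.eval z = (Matrix.vandermonde x).det *
      (p₀ * ∏ i, (x i - z) + ∑ i, p i * ∏ j, (x (i.succAbove j) - z)) := by
    simp [hG, eval_prod, eval_finsetSum]
  have degProd {ι : Type} [Fintype ι] (z : ι → K) :
      (∏ i, (C (z i) - X)).natDegree ≤ Fintype.card ι := by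
    refine (natDegree_prod_le _ _).trans ?_
    calc _ ≤ ∑ _i : ι, 1 := Finset.sum_le_sum fun i _ => by compute_degree
      _ = _ := by simp
  have coeffProd {ι : Type} [Fintype ι] (z : ι → K) :
      (∏ i, (C (z i) - X)).coeff (Fintype.card ι) = (-1) ^ Fintype.card ι := by
    have := coeff_prod_of_natDegree_le (s := Finset.univ) (fun i => C (z i) - X) 1
      (fun i _ => by compute_degree)
    simpa using this
  have degG : G.natDegree ≤ n + 1 := by
    rw [hG]
    refine (natDegree_C_mul_le _ _).trans (natDegree_add_le_of_degree_le ?_ ?_)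
    · exact (natDegree_C_mul_le _ _).trans (by simpa using degProd x)
    · refine natDegree_sum_le_of_forall_le _ _ fun i _ => ?_
      refine (natDegree_C_mul_le _ _).trans ((degProd _).trans ?_)
      simp
  have degF : F.natDegree ≤ n + 1 := by
    simpa using natDegree_det_X_add_C_le (-r) b
  have coeffF : F.coeff (n + 1) = (-1) ^ (n + 1) * shiftedDet s x := by
    have := coeff_det_X_add_C_card (-r) b
    rw [Matrix.det_neg, Fintype.card_fin] at this
    exact this
  have coeffG : G.coeff (n + 1) = (-1) ^ (n + 1) * shiftedDet s x := by
    have h1 := coeffProd x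
    rw [Fintype.card_fin] at h1
    have h2 (i : Fin (n + 1)) : (∏ j, (C (x (i.succAbove j)) - X)).coeff (n + 1) = 0 :=
      coeff_eq_zero_of_natDegree_lt ((degProd _).trans_lt (by simp))
    rw [hG, coeff_C_mul, coeff_add, coeff_C_mul, h1, finsetSum_coeff, h0]
    simp only [coeff_C_mul, h2]
    simp
    ring
  have key : F = G := by
    -- Equality at n + 1 nodes suffices because the coefficients of degree n + 1 cancel in F - G.
    refine Polynomial.eq_of_degree_sub_lt_of_eval_index_eq (v := x) Finset.univ hx.injOn ?_ ?_
    · rw [Finset.card_univ, Fintype.card_fin, degree_lt_iff_coeff_zero]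
      intro k hk
      rcases hk.eq_or_lt with rfl | hk
      · rw [coeff_sub, coeffF, coeffG, sub_self]
      · rw [coeff_sub, coeff_eq_zero_of_natDegree_lt (degF.trans_lt hk),
          coeff_eq_zero_of_natDegree_lt (degG.trans_lt hk), sub_self]
    · intro i _
      rw [evalF, evalG, det_shiftedDeriv_at_node, hp, det_vandermonde_succAbove x i,
        Finset.prod_eq_zero (Finset.mem_univ i) (sub_self _), Finset.sum_eq_single i]
      · rw [Finset.prod_pow]
        ring
      · intro j _ hj
        obtain ⟨k, hk⟩ := Fin.exists_succAbove_eq hj.symm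
        rw [Finset.prod_eq_zero (Finset.mem_univ k) (by rw [hk, sub_self]), mul_zero]
      · simp
  rw [← evalF, key, evalG]

theorem shiftedDet_eq_vandermonde_mul_rectPermanent {K : Type*} [Field K] {m n : ℕ}
    (x : Fin n → K) (y : Fin m → K) (hx : Function.Injective x) (hxy : ∀ i j, x i ≠ y j) :
    shiftedDet (fun i => ∑ j, 1 / (x i - y j)) x =
      (Matrix.vandermonde x).det * rectPermanent (cauchyMatrix x y) := by
  induction m generalizing n with
  | zero =>
    rcases n with _ | n
    · rw [rectPermanent_zero_rows, shiftedDet, Matrix.det_fin_zero, Matrix.det_fin_zero, one_mul]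
    · rw [rectPermanent_eq_zero (Nat.succ_pos n), mul_zero, shiftedDet]
      -- With no y_j every s_i is 0, and the derivative kills the constant polynomial.
      exact Matrix.det_eq_zero_of_column_eq_zero 0 fun i => by simp [shiftedDeriv_apply]
  | succ m ih =>
    rcases n with _ | n
    · rw [rectPermanent_zero_rows, shiftedDet, Matrix.det_fin_zero, Matrix.det_fin_zero, one_mul]
    have hne (i) : x i - y 0 ≠ 0 := sub_ne_zero.2 (hxy i 0)
    have key := det_add_node (fun i => ∑ j : Fin m, 1 / (x i - y j.succ)) x hx
      (rectPermanent (cauchyMatrix x (y ∘ Fin.succ)))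
      (fun i => rectPermanent (cauchyMatrix (x ∘ i.succAbove) (y ∘ Fin.succ)))
      (ih x (y ∘ Fin.succ) hx fun i j => hxy _ _)
      (fun i => ih (x ∘ i.succAbove) (y ∘ Fin.succ)
        (hx.comp Fin.succAbove_right_injective) fun i j => hxy _ _) (y 0)
    have hprod : ∏ i, (x i - y 0) ≠ 0 := Finset.prod_ne_zero_iff.2 fun i _ => hne i
    refine mul_left_cancel₀ hprod ?_
    have h1 : (∏ i, (x i - y 0)) * shiftedDet (fun i => ∑ j, 1 / (x i - y j)) x =
        (Matrix.of fun j (k : Fin (n + 1)) => (x j - y 0) *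
          shiftedDeriv (∑ l : Fin m, 1 / (x j - y l.succ)) (x j) (X ^ (k : ℕ)) +
            x j ^ (k : ℕ)).det := by
      rw [shiftedDet, ← Matrix.det_mul_column]
      congr 1
      ext j k
      simp only [Matrix.of_apply, shiftedDeriv_apply, Fin.sum_univ_succ, eval_pow, eval_X]
      have := hne j
      field_simp
      ring
    rw [h1, key, rectPermanent_succ, mul_left_comm]
    refine congrArg _ ?_
    rw [mul_add, Finset.mul_sum]
    refine congrArg₂ (· + ·) (mul_comm _ _) ?_
    refine Finset.sum_congr rfl fun i _ => ?_
    rw [Fin.prod_univ_succAbove _ i]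
    have h2 : (cauchyMatrix x y).submatrix i.succAbove Fin.succ =
        cauchyMatrix (x ∘ i.succAbove) (y ∘ Fin.succ) := rfl
    have h3 : cauchyMatrix x y i 0 = (x i - y 0)⁻¹ := by simp [cauchyMatrix]
    rw [h2, h3]
    have := hne i
    field_simp

/-! ### Complete homogeneous functions and the Vandermonde matrix -/

theorem mk_eval_hsymm {A σ : Type*} [CommRing A] [Fintype σ] [DecidableEq σ] (x : σ → A) :
    PowerSeries.mk (fun s => MvPolynomial.eval x (MvPolynomial.hsymm σ A s)) =
      ∏ i, PowerSeries.mk fun s => x i ^ s := by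
  ext s
  rw [PowerSeries.coeff_mk, PowerSeries.coeff_prod, MvPolynomial.hsymm, map_sum]
  refine Finset.sum_bij (fun t _ => Multiset.toFinsupp t.1) ?_ ?_ ?_ ?_
  · intro t _
    rw [Finset.mem_finsuppAntidiag]
    refine ⟨?_, Finset.subset_univ _⟩
    have := Multiset.toFinsupp_sum_eq t.1
    rw [Finsupp.sum_fintype _ _ (by simp)] at this
    exact this.trans t.2
  · intro t _ t' _ h
    exact Sym.coe_injective (Multiset.toFinsupp.injective h)
  · intro l hl
    rw [Finset.mem_finsuppAntidiag] at hl
    refine ⟨⟨Finsupp.toMultiset l, ?_⟩, Finset.mem_univ _, Finsupp.toMultiset_toFinsupp l⟩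
    rw [Finsupp.card_toMultiset, ← hl.1, Finsupp.sum_fintype _ _ (by simp)]
    rfl
  · intro t _
    simp only [PowerSeries.coeff_mk]
    rw [← Multiset.prod_hom, Multiset.map_map, Finset.prod_multiset_map_count]
    refine Finset.prod_subset (Finset.subset_univ _) ?_ |>.trans ?_
    · intro i _ hi
      rw [Multiset.mem_toFinset, ← Multiset.count_eq_zero] at hi
      rw [hi, pow_zero]
    · simp

theorem mk_pow_mul {A : Type*} [CommRing A] (a : A) :
    (PowerSeries.mk fun s => a ^ s) * ((1 - C a * X : A[X]) : PowerSeries A) = 1 := by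
  ext s
  rw [Polynomial.coe_sub, Polynomial.coe_mul, Polynomial.coe_one, Polynomial.coe_C,
    Polynomial.coe_X, mul_sub, mul_one, ← mul_assoc]
  rcases s with _ | s
  · simp
  · simp [PowerSeries.coeff_succ_mul_X, PowerSeries.coeff_one, pow_succ]

/-- The polynomial `∏_{j ≠ i} (1 - x_j t)`. -/
noncomputable def complProd {A : Type*} [CommRing A] {n : ℕ} (x : Fin n → A) (i : Fin n) : A[X] :=
  ∏ j ∈ Finset.univ.erase i, (1 - C (x j) * X)

theorem natDegree_complProd_lt {A : Type*} [CommRing A] {n : ℕ} (x : Fin n → A) (i : Fin n) :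
    (complProd x i).natDegree < n := by
  refine (natDegree_prod_le _ _).trans_lt ?_
  calc _ ≤ ∑ _j ∈ Finset.univ.erase i, 1 := Finset.sum_le_sum fun j _ => by compute_degree
    _ < n := by
      rw [Finset.sum_const, Finset.card_erase_of_mem (Finset.mem_univ _), Finset.card_univ,
        Fintype.card_fin]
      simp only [smul_eq_mul, mul_one]
      exact Nat.sub_lt (Fin.pos i) Nat.one_pos

/-- The matrix `(h_{j-i}(X))` with an arbitrary number of columns over a commutative ring. -/
noncomputable def hsymmMatrix {A : Type*} [CommRing A] {n : ℕ} (N : ℕ) (x : Fin n → A) :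
    Matrix (Fin n) (Fin N) A :=
  Matrix.of fun i j => if (i : ℕ) ≤ j then
    MvPolynomial.eval x (MvPolynomial.hsymm (Fin n) A ((j : ℕ) - i)) else 0

/-- In the generating function ∏_j 1/(1 - x_j t) of the h_s, multiplication by `complProd x i`
leaves only 1/(1 - x_i t). -/
theorem complProd_mul_hsymmMatrix {A : Type*} [CommRing A] {n : ℕ} (N : ℕ) (x : Fin n → A) :
    (Matrix.of fun (i r : Fin n) => (complProd x i).coeff r) * hsymmMatrix N x =
      Matrix.of fun i (s : Fin N) => x i ^ (s : ℕ) := by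
  ext i s
  have h1 : ((complProd x i : A[X]) : PowerSeries A) *
      PowerSeries.mk (fun s => MvPolynomial.eval x (MvPolynomial.hsymm (Fin n) A s)) =
      PowerSeries.mk fun s => x i ^ s := by
    rw [mk_eval_hsymm, ← Finset.mul_prod_erase _ _ (Finset.mem_univ i), mul_left_comm]
    conv_rhs => rw [← mul_one (PowerSeries.mk fun s => x i ^ s)]
    congr 1
    have h2 : ((complProd x i : A[X]) : PowerSeries A) =
        ∏ j ∈ Finset.univ.erase i, ((1 - C (x j) * X : A[X]) : PowerSeries A) := by
      simp only [complProd, ← Polynomial.coeToPowerSeries.ringHom_apply, map_prod]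
    rw [h2, ← Finset.prod_mul_distrib]
    exact Finset.prod_eq_one fun j _ => by rw [mul_comm, mk_pow_mul]
  have h3 := congrArg (PowerSeries.coeff (s : ℕ)) h1
  rw [PowerSeries.coeff_mk, PowerSeries.coeff_mul,
    Finset.Nat.sum_antidiagonal_eq_sum_range_succ_mk] at h3
  simp only [PowerSeries.coeff_mk, Polynomial.coeff_coe] at h3
  rw [Matrix.mul_apply, Matrix.of_apply, ← h3]
  simp only [hsymmMatrix, Matrix.of_apply, mul_ite, mul_zero]
  rw [Fin.sum_univ_eq_sum_range (fun r => if r ≤ (s : ℕ) then (complProd x i).coeff r *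
    MvPolynomial.eval x (MvPolynomial.hsymm (Fin n) A ((s : ℕ) - r)) else 0) n,
    ← Finset.sum_filter]
  refine Finset.sum_subset (fun r hr => ?_) fun r hr hr' => ?_
  · simp only [Finset.mem_filter, Finset.mem_range] at hr ⊢
    omega
  · have hn : n ≤ r := by
      simp only [Finset.mem_filter, Finset.mem_range] at hr hr'
      omega
    rw [coeff_eq_zero_of_natDegree_lt ((natDegree_complProd_lt x i).trans_le hn), zero_mul]

theorem det_hsymmMatrix {A : Type*} [CommRing A] {n : ℕ} (x : Fin n → A) :
    (hsymmMatrix n x).det = 1 := by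
  rw [Matrix.det_of_isUpperTriangular]
  · simp [hsymmMatrix]
  · intro i j hij
    exact if_neg (not_le.2 hij)

/-- The coefficient matrix of the `complProd x i` has determinant V, as the case N = n shows: there
the matrix of the h_s is unitriangular. -/
theorem vandermonde_mul_det_hsymmMatrix_mul {A : Type*} [CommRing A] {n N : ℕ} (x : Fin n → A)
    (q : Fin n → A[X]) (hq : ∀ k, (q k).natDegree < N) :
    (Matrix.vandermonde x).det *
      (hsymmMatrix N x * Matrix.of fun (j : Fin N) k => (q k).coeff j).det =
      (Matrix.of fun i k => (q k).eval (x i)).det := by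
  have h1 : (Matrix.vandermonde x).det =
      (Matrix.of fun (i r : Fin n) => (complProd x i).coeff r).det := by
    rw [← mul_one (Matrix.det (Matrix.of _)), ← det_hsymmMatrix x, ← Matrix.det_mul,
      complProd_mul_hsymmMatrix]
    rfl
  rw [h1, ← Matrix.det_mul, ← Matrix.mul_assoc, complProd_mul_hsymmMatrix]
  congr 1
  ext i k
  rw [Matrix.mul_apply, Matrix.of_apply, eval_eq_sum_range' (hq k), Finset.sum_range]
  exact Finset.sum_congr rfl fun j _ => mul_comm _ _

/-! ### The identity of numerators -/

/-- The polynomial `t^k P'(t) - k t^(k-1) P(t)` with `P(t) = ∏ (t - y_j)`, whose coefficients form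
the `k`-th column of the matrix `E(Y)`. -/
noncomputable def columnPoly {A : Type*} [CommRing A] {m : ℕ} (y : Fin m → A) (k : ℕ) : A[X] :=
  X ^ k * derivative (∏ j, (X - C (y j))) - derivative (X ^ k) * ∏ j, (X - C (y j))

theorem natDegree_prod_X_sub_C_le {A : Type*} [CommRing A] {m : ℕ} (y : Fin m → A) :
    (∏ j, (X - C (y j))).natDegree ≤ m := by
  refine (natDegree_prod_le _ _).trans ?_
  calc _ ≤ ∑ _j : Fin m, 1 := Finset.sum_le_sum fun j _ => by compute_degree
    _ = m := by simp

theorem natDegree_columnPoly_lt {A : Type*} [CommRing A] {m n : ℕ} (y : Fin m → A) (hm : 0 < m)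
    (k : Fin n) : (columnPoly y k).natDegree < m + n - 1 := by
  have hk := k.2
  have hP := natDegree_prod_X_sub_C_le y
  have h1 : (X ^ (k : ℕ) * derivative (∏ j, (X - C (y j)))).natDegree ≤ k + (m - 1) :=
    natDegree_mul_le_of_le (natDegree_X_pow_le _)
      ((natDegree_derivative_le _).trans (Nat.sub_le_sub_right hP 1))
  rcases Nat.eq_zero_or_pos (k : ℕ) with h0 | h0
  · have h2 : columnPoly y k = X ^ (k : ℕ) * derivative (∏ j, (X - C (y j))) := by
      simp [columnPoly, h0]
    rw [h2]
    omega
  · have h2 : (derivative (X ^ (k : ℕ)) * ∏ j, (X - C (y j))).natDegree ≤ (k - 1) + m :=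
      natDegree_mul_le_of_le
        ((natDegree_derivative_le _).trans (Nat.sub_le_sub_right (natDegree_X_pow_le _) 1)) hP
    have := natDegree_sub_le_of_le h1 h2
    rw [columnPoly]
    omega

/-- The numerator `∑_f ∏_i ∏_{j ≠ f(i)} (x_i - y_j)` of the permanent of the Cauchy matrix. -/
noncomputable def permNumerator {A : Type*} [CommRing A] {m n : ℕ} (x : Fin n → A)
    (y : Fin m → A) : A :=
  ∑ f : Fin n ↪ Fin m, ∏ i, ∏ j ∈ Finset.univ.erase (f i), (x i - y j)

/-- The determinant of the product of the two matrices over a commutative ring. -/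
noncomputable def detHE {A : Type*} [CommRing A] {m n : ℕ} (x : Fin n → A) (y : Fin m → A) : A :=
  (hsymmMatrix (m + n - 1) x *
    Matrix.of fun (j : Fin (m + n - 1)) (k : Fin n) => (columnPoly y k).coeff j).det

/-- Compatibility with ring maps lets the identity pass to a fraction field and specialise at t = 0.
-/
theorem map_permNumerator {A B : Type*} [CommRing A] [CommRing B] (φ : A →+* B) {m n : ℕ}
    (x : Fin n → A) (y : Fin m → A) :
    φ (permNumerator x y) = permNumerator (φ ∘ x) (φ ∘ y) := by
  simp [permNumerator, map_sum, map_prod]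

theorem map_detHE {A B : Type*} [CommRing A] [CommRing B] (φ : A →+* B) {m n : ℕ}
    (x : Fin n → A) (y : Fin m → A) :
    φ (detHE x y) = detHE (φ ∘ x) (φ ∘ y) := by
  rw [detHE, RingHom.map_det, detHE, RingHom.mapMatrix_apply, Matrix.map_mul]
  have hE (k : ℕ) : columnPoly (φ ∘ y) k = (columnPoly y k).map φ := by
    simp [columnPoly, Polynomial.map_prod, ← derivative_map]
  congr 2
  · ext i j
    simp only [hsymmMatrix, Matrix.map_apply, Matrix.of_apply]
    split_ifs
    · simp [MvPolynomial.hsymm, ← Multiset.prod_hom]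
    · exact map_zero φ
  · ext j k
    simp [hE]

theorem rectPermanent_cauchyMatrix {K : Type*} [Field K] {m n : ℕ} (x : Fin n → K) (y : Fin m → K)
    (hxy : ∀ i j, x i ≠ y j) : R x y * rectPermanent (cauchyMatrix x y) = permNumerator x y := by
  rw [rectPermanent, permNumerator, Finset.mul_sum]
  refine Finset.sum_congr rfl fun f _ => ?_
  rw [R, ← Finset.prod_mul_distrib]
  refine Finset.prod_congr rfl fun i _ => ?_
  rw [← Finset.mul_prod_erase _ _ (Finset.mem_univ (f i))]
  have := sub_ne_zero.2 (hxy i (f i))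
  simp only [cauchyMatrix, Matrix.of_apply]
  field_simp

theorem detHE_eq_of_injective {K : Type*} [Field K] {m n : ℕ} (hm : 0 < m) (x : Fin n → K)
    (y : Fin m → K) (hx : Function.Injective x) (hxy : ∀ i j, x i ≠ y j) :
    detHE x y = permNumerator x y := by
  have hV : (Matrix.vandermonde x).det ≠ 0 := Matrix.det_vandermonde_ne_zero_iff.2 hx
  refine mul_left_cancel₀ hV ?_
  rw [detHE, vandermonde_mul_det_hsymmMatrix_mul x (fun k => columnPoly y k)
    fun k => natDegree_columnPoly_lt y hm k, ← rectPermanent_cauchyMatrix x y hxy, mul_left_comm,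
    ← shiftedDet_eq_vandermonde_mul_rectPermanent x y hx hxy, R, shiftedDet,
    ← Matrix.det_mul_column]
  congr 1
  ext i k
  have hP : (derivative (∏ j, (X - C (y j)))).eval (x i) =
      (∏ j, (x i - y j)) * ∑ j, 1 / (x i - y j) := by
    rw [derivative_prod_finset, eval_finsetSum, Finset.mul_sum]
    refine Finset.sum_congr rfl fun j _ => ?_
    rw [← Finset.mul_prod_erase Finset.univ (fun j => x i - y j) (Finset.mem_univ j)]
    have := sub_ne_zero.2 (hxy i j)
    simp only [eval_mul, eval_prod, eval_sub, eval_X, eval_C, derivative_sub, derivative_X,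
      derivative_C, sub_zero, eval_one]
    field_simp
  simp only [Matrix.of_apply, columnPoly, eval_sub, eval_mul, hP, eval_prod, shiftedDeriv_apply,
    eval_X, eval_C, eval_pow]
  ring

/-- The identity of numerators, also for coinciding `x_i`: perturb `x_i` to `x_i + t^(i+1)`. -/
theorem detHE_eq_permNumerator {K : Type*} [Field K] {m n : ℕ} (hm : 0 < m) (x : Fin n → K)
    (y : Fin m → K) : detHE x y = permNumerator x y := by
  -- Distinct degrees keep the x'_i apart; positive degrees keep them away from the constants y'_j.
  set x' : Fin n → K[X] := fun i => C (x i) + X ^ ((i : ℕ) + 1) with hx'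
  set y' : Fin m → K[X] := fun j => C (y j) with hy'
  have deg (i : Fin n) : (x' i).natDegree = i + 1 := by
    rw [hx']
    simp only [natDegree_C_add, natDegree_X_pow]
  have inj : Function.Injective x' := fun i j h => by
    have := congrArg natDegree h
    rw [deg, deg] at this
    exact Fin.ext (by omega)
  have ne (i j) : x' i ≠ y' j := fun h => by
    have := congrArg natDegree h
    rw [deg, hy'] at this
    simp at this
  let ι := algebraMap K[X] (FractionRing K[X])
  have hι : Function.Injective ι := IsFractionRing.injective _ _
  have key : detHE x' y' = permNumerator x' y' := hι <| by
    rw [map_detHE, map_permNumerator]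
    exact detHE_eq_of_injective hm _ _ (hι.comp inj) fun i j h => ne i j (hι h)
  have hxe : evalRingHom 0 ∘ x' = x := by
    ext i
    simp [hx']
  have hye : evalRingHom 0 ∘ y' = y := by
    ext i
    simp [hy']
  have := congrArg (evalRingHom 0) key
  rwa [map_detHE, map_permNumerator, hxe, hye] at this

/-! ### Identification of the matrix entries -/

theorem coeff_prod_X_sub_C {K : Type*} [Field K] {m : ℕ} (y : Fin m → K) (s : ℕ) :
    (∏ j, (X - C (y j))).coeff s = (-1) ^ ((m : ℤ) - s) * e y ((m : ℤ) - s) := by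
  by_cases hs : s ≤ m
  · have h := Multiset.prod_X_sub_C_coeff (Finset.univ.val.map y) (k := s) (by simpa using hs)
    have h1 : ((Finset.univ.val.map y).map fun t => X - C t).prod = ∏ j, (X - C (y j)) := by
      rw [Multiset.map_map]
      rfl
    rw [h1] at h
    have h2 : (m : ℤ) - s = ((m - s : ℕ) : ℤ) := by omega
    rw [h, h2, zpow_natCast, e, if_pos (by omega), Int.toNat_natCast,
      ← MvPolynomial.aeval_esymm_eq_multiset_esymm (Fin m) K]
    simp [MvPolynomial.aeval_eq_eval]
  · rw [coeff_eq_zero_of_natDegree_lt ((natDegree_prod_X_sub_C_le y).trans_lt (by omega)), e,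
      if_neg (by omega), mul_zero]

theorem matrixE_eq {K : Type*} [Field K] {m : ℕ} (n : ℕ) (y : Fin m → K) :
    matrixE n y = Matrix.of fun (j : Fin (m + n - 1)) (k : Fin n) => (columnPoly y k).coeff j := by
  ext j k
  simp only [matrixE, Matrix.of_apply, entryE, columnPoly, coeff_sub, coeff_X_pow_mul']
  obtain ⟨j, hj⟩ := j
  obtain ⟨k, hk⟩ := k
  simp only [derivative_X_pow]
  have hterm : (C (k : K) * X ^ (k - 1) * ∏ j, (X - C (y j))).coeff j =
      if k ≤ j + 1 then (k : K) * (∏ j, (X - C (y j))).coeff (j + 1 - k) else 0 := by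
    rw [mul_assoc, coeff_C_mul, coeff_X_pow_mul']
    rcases k with _ | k
    · simp
    · simp
  rw [hterm, coeff_derivative]
  by_cases hkj : k ≤ j + 1
  -- Both terms involve the coefficient of t^l in P, with weights l and k. For l = 0 the first term
  -- is absent, matching its weight.
  · obtain ⟨l, hl⟩ := Nat.exists_eq_add_of_le hkj
    have h1 : (m : ℤ) - ((j : ℤ) + 1) + ((k : ℤ) + 1) - 1 = (m : ℤ) - l := by omega
    have h2 : ((j : ℤ) + 1) - 2 * ((k : ℤ) + 1) + 2 = (l : ℤ) - k := by omega
    have h3 : j + 1 - k = l := by omega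
    rw [h1, h2, h3, if_pos hkj, mul_assoc, ← coeff_prod_X_sub_C]
    rcases l with _ | l
    · rw [if_neg (by omega)]
      simp
    · have h4 : j - k = l := by omega
      rw [if_pos (by omega), h4]
      push_cast
      ring
  -- Here the degree of e exceeds m, so the entry vanishes.
  · have h1 : (m : ℤ) - ((j : ℤ) + 1) + ((k : ℤ) + 1) - 1 = ((m + (k - j - 1) : ℕ) : ℤ) := by
      omega
    have h2 : e y ((m + (k - j - 1) : ℕ) : ℤ) = 0 := by
      rw [e, if_pos (by omega), Int.toNat_natCast, MvPolynomial.esymm,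
        Finset.powersetCard_eq_empty.2 (by simp; omega)]
      simp
    rw [if_neg hkj, if_neg (by omega), h1, h2, mul_zero, sub_zero]

theorem matrixH_eq {K : Type*} [Field K] {n : ℕ} (m : ℕ) (x : Fin n → K) :
    matrixH m x = hsymmMatrix (m + n - 1) x := by
  ext i j
  simp only [matrixH, hsymmMatrix, Matrix.of_apply, h, add_sub_add_right_eq_sub, sub_nonneg,
    Nat.cast_le]
  split_ifs with hij
  · congr 2
    omega
  · rfl

end ScottPermanent

theorem theorem1 {K : Type*} [Field K] (m n : ℕ) (hm : 0 < m) (hn : 0 < n)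
    (x : Fin n → K) (y : Fin m → K) (hxy : ∀ i j, x i ≠ y j) :
    ScottPermanent.rectPermanent (ScottPermanent.cauchyMatrix x y) =
        (ScottPermanent.matrixH m x * ScottPermanent.matrixE n y).det / ScottPermanent.R x y ∧
      (m < n →
        ScottPermanent.rectPermanent (ScottPermanent.cauchyMatrix x y) = 0 ∧
          (ScottPermanent.matrixH m x * ScottPermanent.matrixE n y).det = 0) := by
  have hR : ScottPermanent.R x y ≠ 0 :=
    Finset.prod_ne_zero_iff.2 fun i _ => Finset.prod_ne_zero_iff.2 fun j _ =>
      sub_ne_zero.2 (hxy i j)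
  have hdet : (ScottPermanent.matrixH m x * ScottPermanent.matrixE n y).det =
      ScottPermanent.R x y * ScottPermanent.rectPermanent (ScottPermanent.cauchyMatrix x y) := by
    rw [ScottPermanent.matrixH_eq, ScottPermanent.matrixE_eq,
      ScottPermanent.rectPermanent_cauchyMatrix x y hxy,
      ← ScottPermanent.detHE_eq_permNumerator hm, ScottPermanent.detHE]
  refine ⟨by rw [hdet, mul_div_cancel_left₀ _ hR], fun hmn => ?_⟩
  have h0 := ScottPermanent.rectPermanent_eq_zero hmn (ScottPermanent.cauchyMatrix x y)
  exact ⟨h0, by rw [hdet, h0, mul_zero]⟩
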